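/- Let $d\ge 1$ and $\sigma>0$. For $x,y\in\mathbb R^d$ let $K(x,y)=e^{-\|x-y\|^2/(2\sigma^2)}$ be the Gaussian kernel and $D_K(x,y)=\sqrt{K(x,x)+K(y,y)-2K(x,y)}$ the kernel distance. Let $\omega_1,\dots,\omega_t$ be independent random vectors with law $\mathcal N_d(0,\sigma^{-2}I)$, let $\hat\phi(x)\in\mathbb R^{2t}$ be the random Fourier feature vector whose $t$ coordinate pairs are $\frac1{\sqrt t}\bigl(\cos\langle\omega_i,x\rangle,\ \sin\langle\omega_i,x\rangle\bigr)$, and set $\hat K(x,y)=\langle\hat\phi(x),\hat\phi(y)\rangle$ and $D_{\hat K}(x,y)=\sqrt{\hat K(x,x)+\hat K(y,y)-2\hat K(x,y)}=\|\hat\phi(x)-\hat\phi(y)\|$. There is an absolute constant $C>0$ such that for all $d\ge1$, $\sigma>0$, $\varepsilon\in(0,1)$, $\delta\in(0,1)$, $\mathcal M\ge 0$ and all natural numbers $$t\ \ge\ C\,\frac{d}{\varepsilon^2}\,\log\!\Bigl(\frac d\varepsilon\cdot\frac{\max(\mathcal M,1)}{\delta}\Bigr),$$ with probability at least $1-\delta$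 the bound $$\frac{D_{\hat K}(x,y)^2}{D_K(x,y)^2}\in[1-\varepsilon,\,1+\varepsilon]$$ holds simultaneously for all $x\ne y$ in $\mathbb R^d$ with $\|x-y\|/\sigma\le\mathcal M$. -/

import Mathlib

open MeasureTheory ProbabilityTheory

noncomputable section

/-- The Gaussian kernel `K(x,y) = exp(-‖x-y‖² / (2σ²))` on `ℝ^d`. -/
def gaussianKernel {d : ℕ} (σ : ℝ) (x y : EuclideanSpace ℝ (Fin d)) : ℝ :=
  Real.exp (-‖x - y‖ ^ 2 / (2 * σ ^ 2))

/-- The distance `√(k(x,x) + k(y,y) - 2 k(x,y))` induced by a kernel `k`. -/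
def kernelDist {X : Type*} (k : X → X → ℝ) (x y : X) : ℝ :=
  √(k x x + k y y - 2 * k x y)

/-- The random Fourier feature map with frequencies `w₁, …, w_t`: its `t` coordinate pairs are
`(cos ⟨wᵢ, x⟩, sin ⟨wᵢ, x⟩) / √t`, so that it takes values in a Euclidean space of dimension
`m = 2t`. -/
def fourierFeatures {d t : ℕ} (w : Fin t → EuclideanSpace ℝ (Fin d))
    (x : EuclideanSpace ℝ (Fin d)) : EuclideanSpace ℝ (Fin t × Fin 2) :=
  WithLp.toLp 2 fun p =>
    (![Real.cos (inner ℝ (w p.1) x), Real.sin (inner ℝ (w p.1) x)] p.2) / √(t : ℝ)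

/-- The kernel `⟨φ(x), φ(y)⟩` induced by the random Fourier feature map. -/
def featureKernel {d t : ℕ} (w : Fin t → EuclideanSpace ℝ (Fin d))
    (x y : EuclideanSpace ℝ (Fin d)) : ℝ :=
  inner ℝ (fourierFeatures w x) (fourierFeatures w y)

/-- The distance induced by the feature kernel is the Euclidean distance of the features. -/
theorem kernelDist_featureKernel {d t : ℕ} (w : Fin t → EuclideanSpace ℝ (Fin d))
    (x y : EuclideanSpace ℝ (Fin d)) :
    kernelDist (featureKernel w) x y = ‖fourierFeatures w x - fourierFeatures w y‖ := by
  unfold kernelDist featureKernel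
  rw [← Real.sqrt_sq (norm_nonneg (fourierFeatures w x - fourierFeatures w y)),
    norm_sub_sq_real, real_inner_self_eq_norm_sq, real_inner_self_eq_norm_sq]
  congr 1
  ring

end

/-! With `u = (x - y) / σ` and standard Gaussian vectors `gᵢ = σ wᵢ`, the ratio of squared distances
is `cosDefect g u / gaussianDefect ‖u‖`: an empirical mean over its expectation. The task is a
relative deviation bound uniform over a ball, including `u → 0`, where both sides vanish.

For fixed `u`, the normalized summand `(1 - cos (a z)) / gaussianDefect a` is at most quadratic in
`z`, uniformly in `a = ‖u‖` (`abs_centredCos_le`). Chernoff then gives failure probability `2 exp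
(-c t ε²)` at every scale (`exists_measureReal_cosDefect_le`).

For uniformity, let `R` bound the mean of `‖gᵢ‖⁴`. A net and a Lipschitz estimate handle `‖u‖ ≥ r`.
Below `r`, both defects are quadratic up to fourth-order errors, so the estimate on the sphere of
radius `r` scales down to the origin (`abs_cosDefect_sub_gaussianDefect_le_of_net`). Markov's
inequality supplies `R`, and the net has cardinality polynomial in `Q = (d/ε)(M/δ)` to the power
`d`, which yields `t ≳ (d/ε²)(1 + log Q)`.

The extra `1` matters only when `log Q` is near `0`, that is `d = 1` with `ε`, `δ`, `M` all near
`1`. There either `t` is large enough for the bound at failure probability `1/2`, or `t` is bounded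
and an explicit event of positive probability suffices. -/

/-! ### Elementary estimates for the cosine and the Gaussian defect. -/

lemma cos_le_one_sub_sq_div_two_add (x : ℝ) : Real.cos x ≤ 1 - x ^ 2 / 2 + x ^ 4 / 2 := by
  rcases le_total |x| 1 with h | h
  · have h1 := (abs_le.1 (Real.cos_bound h)).2
    have h2 : |x| ^ 4 = x ^ 4 := by rw [← abs_pow, abs_of_nonneg (by positivity)]
    rw [h2] at h1
    nlinarith [show 0 ≤ x ^ 4 by positivity]
  · have h2 : 1 ≤ x ^ 2 := by rw [← sq_abs]; nlinarith
    nlinarith [Real.cos_le_one x]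

/-- The mean of `1 - cos ⟨g, u⟩` for a standard Gaussian vector `g`, in terms of `a = ‖u‖`. -/
noncomputable def gaussianDefect (a : ℝ) : ℝ := 1 - Real.exp (-a ^ 2 / 2)

lemma gaussianDefect_le (a : ℝ) : gaussianDefect a ≤ a ^ 2 / 2 := by
  have := Real.add_one_le_exp (-a ^ 2 / 2)
  unfold gaussianDefect; linarith

/-- With `b = a ^ 2 / 2` this is `1 - exp (-b) ≥ b / (1 + b)`, free of division; the lower bounds on
the defect below derive from it. -/
lemma le_gaussianDefect_mul (a : ℝ) : a ^ 2 / 2 ≤ gaussianDefect a * (1 + a ^ 2 / 2) := by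
  have h := Real.add_one_le_exp (a ^ 2 / 2)
  have h2 : Real.exp (-a ^ 2 / 2) * Real.exp (a ^ 2 / 2) = 1 := by
    rw [← Real.exp_add]; simp [neg_div]
  have h3 := Real.exp_pos (-a ^ 2 / 2)
  unfold gaussianDefect
  nlinarith

lemma gaussianDefect_nonneg (a : ℝ) : 0 ≤ gaussianDefect a := by
  have := le_gaussianDefect_mul a
  by_contra! h
  nlinarith [sq_nonneg a]

lemma gaussianDefect_pos {a : ℝ} (ha : 0 < a) : 0 < gaussianDefect a := by
  have := le_gaussianDefect_mul a
  by_contra! h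
  nlinarith [sq_pos_of_pos ha]

lemma sub_le_gaussianDefect (a : ℝ) : a ^ 2 / 2 - a ^ 4 / 4 ≤ gaussianDefect a := by
  have h := le_gaussianDefect_mul a
  have h1 := gaussianDefect_nonneg a
  have h2 := gaussianDefect_le a
  nlinarith [mul_le_mul_of_nonneg_right h2 (show 0 ≤ a ^ 2 / 2 by positivity)]

lemma sq_le_four_mul_gaussianDefect {a : ℝ} (h0 : 0 ≤ a) (h1 : a ≤ 1) :
    a ^ 2 ≤ 4 * gaussianDefect a := by
  have h := le_gaussianDefect_mul a
  have h3 := gaussianDefect_nonneg a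
  have : a ^ 2 ≤ 1 := by nlinarith
  nlinarith

lemma gaussianDefect_mono {a b : ℝ} (h0 : 0 ≤ a) (h : a ≤ b) :
    gaussianDefect a ≤ gaussianDefect b := by
  unfold gaussianDefect
  have : Real.exp (-b ^ 2 / 2) ≤ Real.exp (-a ^ 2 / 2) := by
    apply Real.exp_le_exp.2
    nlinarith
  linarith

lemma abs_gaussianDefect_sub_le (a b : ℝ) :
    |gaussianDefect a - gaussianDefect b| ≤ |a - b| := by
  have key : ∀ x : ℝ, HasDerivAt gaussianDefect (x * Real.exp (-x ^ 2 / 2)) x := by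
    intro x
    have := ((((hasDerivAt_pow 2 x).neg).div_const 2).exp).const_sub 1
    refine HasDerivAt.congr_deriv (f := gaussianDefect) this ?_
    simp only [Pi.neg_apply]
    push_cast
    ring
  have := Convex.norm_image_sub_le_of_norm_hasDerivWithin_le (f := gaussianDefect) (C := 1)
    (s := Set.univ) (x := b) (y := a) (fun x _ => (key x).hasDerivWithinAt) (fun x _ => ?_)
    convex_univ (Set.mem_univ _) (Set.mem_univ _)
  · simpa using this
  · have h := Real.add_one_le_exp (x ^ 2 / 2)
    have h2 : Real.exp (-x ^ 2 / 2) * Real.exp (x ^ 2 / 2) = 1 := by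
      rw [← Real.exp_add]; simp [neg_div]
    have h3 := Real.exp_pos (-x ^ 2 / 2)
    rw [norm_mul, Real.norm_eq_abs, Real.norm_eq_abs, abs_of_pos h3, ← h2, mul_comm]
    apply mul_le_mul_of_nonneg_left _ h3.le
    nlinarith [sq_nonneg (|x| - 1), sq_abs x]

/-! ### From a net and a fourth-moment bound to the whole ball. -/

section deterministic

variable {E : Type*} [NormedAddCommGroup E] [InnerProductSpace ℝ E] {t : ℕ}

/-- The empirical mean of `1 - cos ⟨gᵢ, u⟩`. -/
noncomputable def cosDefect (g : Fin t → E) (u : E) : ℝ :=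
  (∑ i, (1 - Real.cos (inner ℝ (g i) u))) / t

lemma abs_sum_div_le (ht : 0 < t) {f : Fin t → ℝ} {b : Fin t → ℝ} (h : ∀ i, |f i| ≤ b i) :
    |(∑ i, f i) / t| ≤ (∑ i, b i) / t := by
  have : (0 : ℝ) < t := by exact_mod_cast ht
  rw [abs_div, abs_of_pos this]
  gcongr
  exact (Finset.abs_sum_le_sum_abs _ _).trans (Finset.sum_le_sum fun i _ => h i)

/-- The Lipschitz constant is the mean of `‖gᵢ‖`; since `‖g‖ ≤ 1 + ‖g‖ ^ 4`, the fourth moment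
controls it too, so one `R` serves everywhere. -/
lemma abs_cosDefect_sub_le (ht : 0 < t) (g : Fin t → E) {R : ℝ}
    (hR : (∑ i, ‖g i‖ ^ 4) / t ≤ R) (u v : E) :
    |cosDefect g u - cosDefect g v| ≤ (1 + R) * ‖u - v‖ := by
  have ht' : (0 : ℝ) < t := by exact_mod_cast ht
  have h1 : cosDefect g u - cosDefect g v =
      (∑ i, (Real.cos (inner ℝ (g i) v) - Real.cos (inner ℝ (g i) u))) / t := by
    unfold cosDefect
    rw [← sub_div, ← Finset.sum_sub_distrib]
    congr 1
    exact Finset.sum_congr rfl fun i _ => by ring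
  rw [h1]
  refine (abs_sum_div_le ht (b := fun i => (1 + ‖g i‖ ^ 4) * ‖u - v‖) fun i => ?_).trans ?_
  · refine (Real.abs_cos_sub_cos_le _ _).trans ?_
    rw [← inner_sub_right, norm_sub_rev u v]
    refine (abs_real_inner_le_norm _ _).trans ?_
    gcongr
    nlinarith [sq_nonneg (‖g i‖ ^ 2 - 1), sq_nonneg (‖g i‖ - 1), norm_nonneg (g i)]
  · rw [← Finset.sum_mul, Finset.sum_add_distrib, mul_div_right_comm, add_div]
    gcongr
    simp [ht'.ne']

/-- The quadratic Taylor terms cancel exactly in the difference. The error keeps the factor `s ^ 2`,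
so it remains relatively small as `s → 0`. -/
lemma abs_cosDefect_smul_sub_le (ht : 0 < t) (g : Fin t → E) {R : ℝ}
    (hR : (∑ i, ‖g i‖ ^ 4) / t ≤ R) (u : E) {s : ℝ} (hs0 : 0 ≤ s) (hs1 : s ≤ 1) :
    |cosDefect g (s • u) - s ^ 2 * cosDefect g u| ≤ s ^ 2 * ‖u‖ ^ 4 * R := by
  have h1 : cosDefect g (s • u) - s ^ 2 * cosDefect g u =
      (∑ i, ((1 - Real.cos (inner ℝ (g i) (s • u))) -
        s ^ 2 * (1 - Real.cos (inner ℝ (g i) u)))) / t := by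
    unfold cosDefect
    rw [← mul_div_assoc, ← sub_div, Finset.mul_sum, ← Finset.sum_sub_distrib]
  rw [h1]
  refine (abs_sum_div_le ht
    (b := fun i => s ^ 2 * ‖u‖ ^ 4 * ‖g i‖ ^ 4) fun i => ?_).trans ?_
  · rw [inner_smul_right]
    set x := inner ℝ (g i) u
    have hx : x ^ 4 ≤ ‖u‖ ^ 4 * ‖g i‖ ^ 4 := by
      have := pow_le_pow_left₀ (abs_nonneg _) (abs_real_inner_le_norm (g i) u) 4
      rw [← abs_pow, abs_of_nonneg (by positivity), mul_pow] at this
      linarith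
    have a1 := cos_le_one_sub_sq_div_two_add x
    have a2 := Real.one_sub_sq_div_two_le_cos (x := x)
    have b1 := cos_le_one_sub_sq_div_two_add (s * x)
    have b2 := Real.one_sub_sq_div_two_le_cos (x := s * x)
    have hs2 : s ^ 2 ≤ 1 := by nlinarith
    have hs4 : s ^ 4 * x ^ 4 ≤ s ^ 2 * x ^ 4 := by
      gcongr ?_ * _
      nlinarith [sq_nonneg s]
    have hx4 : 0 ≤ x ^ 4 := by positivity
    have h5 := mul_le_mul_of_nonneg_left hx (sq_nonneg s)
    rw [mul_pow] at b1 b2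
    rw [mul_pow] at b1
    have h6 := mul_le_mul_of_nonneg_left a1 (sq_nonneg s)
    have h7 := mul_le_mul_of_nonneg_left a2 (sq_nonneg s)
    have h8 : 0 ≤ s ^ 2 * x ^ 4 := by positivity
    rw [abs_le]
    constructor <;> nlinarith
  · rw [← Finset.mul_sum, mul_div_assoc]
    gcongr

lemma abs_gaussianDefect_mul_sub_le (a : ℝ) {s : ℝ} (hs0 : 0 ≤ s) (hs1 : s ≤ 1) :
    |gaussianDefect (s * a) - s ^ 2 * gaussianDefect a| ≤ s ^ 2 * a ^ 4 / 4 := by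
  have a1 := gaussianDefect_le a
  have a2 := sub_le_gaussianDefect a
  have b1 := gaussianDefect_le (s * a)
  have b2 := sub_le_gaussianDefect (s * a)
  have hs2 : s ^ 2 ≤ 1 := by nlinarith
  have hs4 : s ^ 4 * a ^ 4 ≤ s ^ 2 * a ^ 4 := by
    gcongr ?_ * _
    nlinarith [sq_nonneg s]
  have h6 := mul_le_mul_of_nonneg_left a1 (sq_nonneg s)
  have h7 := mul_le_mul_of_nonneg_left a2 (sq_nonneg s)
  rw [mul_pow] at b1 b2
  rw [mul_pow] at b2
  rw [abs_le]
  constructor <;> nlinarith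

lemma abs_cosDefect_sub_gaussianDefect_le_of_near (ht : 0 < t) (g : Fin t → E) {R ε r η : ℝ}
    (hR0 : 0 ≤ R) (hR : (∑ i, ‖g i‖ ^ 4) / t ≤ R) (hε : 0 < ε) (hε1 : ε < 1)
    (hr0 : 0 < r) (hr1 : r ≤ 1) (hη : η = ε * r ^ 2 / (16 * (R + 3))) {u v : E} (hu : r ≤ ‖u‖)
    (huv : ‖u - v‖ ≤ η)
    (hv : |cosDefect g v - gaussianDefect ‖v‖| ≤ ε / 4 * gaussianDefect ‖v‖) :
    |cosDefect g u - gaussianDefect ‖u‖| ≤ ε / 2 * gaussianDefect ‖u‖ := by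
  have h2 := abs_cosDefect_sub_le ht g hR u v
  have h3 := (abs_gaussianDefect_sub_le ‖u‖ ‖v‖).trans (abs_norm_sub_norm_le u v)
  have h4 : r ^ 2 ≤ 4 * gaussianDefect ‖u‖ :=
    (sq_le_four_mul_gaussianDefect hr0.le hr1).trans
      (by linarith [gaussianDefect_mono hr0.le hu])
  -- The `R + 3` collects `1 + R` from `cosDefect`, `1` from `gaussianDefect`, and `1` for replacing
  -- `v` by `u` in the error allowed at `v`.
  have h5 : (R + 3) * η ≤ ε / 4 * gaussianDefect ‖u‖ := by
    have : (R + 3) * η = ε * r ^ 2 / 16 := by rw [hη]; field_simp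
    rw [this]; nlinarith
  have h6 : (1 + R) * ‖u - v‖ ≤ (1 + R) * η := by gcongr
  have hη0 : 0 ≤ η := (norm_nonneg _).trans huv
  have h7 := abs_le.1 h3
  have h9 : ε / 4 * gaussianDefect ‖v‖ ≤ ε / 4 * (gaussianDefect ‖u‖ + η) := by
    gcongr; linarith
  have h10 : ε / 4 * η ≤ η := mul_le_of_le_one_left hη0 (by linarith)
  have h11 := abs_le.1 hv
  have h12 := abs_le.1 h2
  rw [abs_le]
  constructor <;> linarith

/-- Control of the fourth moment and of the deviation on a net gives uniform relative control
on a ball. -/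
lemma abs_cosDefect_sub_gaussianDefect_le_of_net (ht : 0 < t) (g : Fin t → E) {R ε M r η : ℝ}
    (hR0 : 0 ≤ R) (hR : (∑ i, ‖g i‖ ^ 4) / t ≤ R) (hε : 0 < ε) (hε1 : ε < 1)
    (hr0 : 0 < r) (hr : r ^ 2 = ε / (8 * (R + 1))) (hη : η = ε * r ^ 2 / (16 * (R + 3)))
    (hM : 1 ≤ M) (N : Set E) (hN : ∀ u : E, ‖u‖ ≤ M → ∃ v ∈ N, ‖u - v‖ ≤ η)
    (hdev : ∀ v ∈ N, |cosDefect g v - gaussianDefect ‖v‖| ≤ ε / 4 * gaussianDefect ‖v‖)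
    (u : E) (hu : ‖u‖ ≤ M) :
    |cosDefect g u - gaussianDefect ‖u‖| ≤ ε * gaussianDefect ‖u‖ := by
  have hr1 : r ≤ 1 := by
    have : r ^ 2 ≤ 1 := by
      rw [hr, div_le_one (by positivity)]; linarith
    nlinarith
  have annulus : ∀ u : E, r ≤ ‖u‖ → ‖u‖ ≤ M →
      |cosDefect g u - gaussianDefect ‖u‖| ≤ ε / 2 * gaussianDefect ‖u‖ := by
    intro u hru hu
    obtain ⟨v, hv, huv⟩ := hN u hu
    exact abs_cosDefect_sub_gaussianDefect_le_of_near ht g hR0 hR hε hε1 hr0 hr1 hη hru huv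
      (hdev v hv)
  rcases le_total r ‖u‖ with h | h
  · refine (annulus u h hu).trans ?_
    have := mul_nonneg hε.le (gaussianDefect_nonneg ‖u‖)
    linarith
  rcases eq_or_ne u 0 with rfl | hu0
  · simp [cosDefect, gaussianDefect]
  have hupos : 0 < ‖u‖ := norm_pos_iff.2 hu0
  -- Inside the small ball, compare `u = s • v` with the point `v` on the sphere of radius `r`.
  set s := ‖u‖ / r with hs
  have hs0 : 0 < s := by positivity
  have hs1 : s ≤ 1 := (div_le_one hr0).2 h
  have hsr : s * r = ‖u‖ := by rw [hs]; field_simp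
  obtain ⟨v, hsv⟩ : ∃ v, s • v = u := ⟨s⁻¹ • u, smul_inv_smul₀ hs0.ne' u⟩
  have hnorm : ‖v‖ = r := by
    have : s * ‖v‖ = s * r := by
      rw [hsr, ← hsv, norm_smul, Real.norm_of_nonneg hs0.le]
    exact mul_left_cancel₀ hs0.ne' this
  have h1 := annulus v hnorm.ge (by linarith)
  have h2 := abs_cosDefect_smul_sub_le ht g hR v hs0.le hs1
  have h3 := abs_gaussianDefect_mul_sub_le r hs0.le hs1
  rw [hsv, hnorm] at h2
  rw [hnorm] at h1
  rw [hsr] at h3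
  have h4 := sq_le_four_mul_gaussianDefect hupos.le (h.trans hr1)
  clear_value s
  generalize cosDefect g u = A at *
  generalize cosDefect g v = B at *
  generalize gaussianDefect ‖u‖ = k at *
  generalize gaussianDefect r = l at *
  -- The value of `r` is chosen so that this scaling error equals `ε ‖u‖ ^ 2 / 8`, while `‖u‖ ^ 2 ≤
  -- 4 k`.
  have h5 : s ^ 2 * r ^ 4 * R + s ^ 2 * r ^ 4 ≤ ε / 2 * k := by
    have : s ^ 2 * r ^ 4 * R + s ^ 2 * r ^ 4 = ‖u‖ ^ 2 * (ε / 8) := by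
      have e : s ^ 2 * r ^ 4 * R + s ^ 2 * r ^ 4 = (s * r) ^ 2 * (r ^ 2 * (R + 1)) := by ring
      rw [e, hsr, hr]; field_simp
    rw [this]; nlinarith
  have h6 := abs_le.1 h2
  have h7 := abs_le.1 h3
  have h8 : |s ^ 2 * B - s ^ 2 * l| ≤ ε / 2 * (s ^ 2 * l) := by
    rw [← mul_sub, abs_mul, abs_of_nonneg (sq_nonneg s)]
    calc _ ≤ s ^ 2 * (ε / 2 * l) := by gcongr
      _ = _ := by ring
  have h9 := abs_le.1 h8
  have h12 : 0 ≤ s ^ 2 * r ^ 4 := by positivity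
  have h10 : ε / 2 * (s ^ 2 * l) ≤ ε / 2 * k + s ^ 2 * r ^ 4 / 4 := by
    have : ε / 2 * (s ^ 2 * l) ≤ ε / 2 * (k + s ^ 2 * r ^ 4 / 4) := by gcongr; linarith
    have h14 : ε / 2 * (s ^ 2 * r ^ 4 / 4) ≤ s ^ 2 * r ^ 4 / 4 :=
      mul_le_of_le_one_left (by positivity) (by linarith)
    linarith
  rw [abs_le]
  constructor <;> linarith

end deterministic

/-! ### Covering a ball by a grid. -/

/-- A grid of step `h` covers a ball in the Euclidean space. -/
lemma exists_finset_covering {d : ℕ} {h M : ℝ} (hh : 0 < h) :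
    ∃ N : Finset (EuclideanSpace ℝ (Fin d)), N.card ≤ (2 * ⌈M / h⌉₊ + 1) ^ d ∧
      ∀ u : EuclideanSpace ℝ (Fin d), ‖u‖ ≤ M → ∃ v ∈ N, ‖u - v‖ ≤ d * h := by
  classical
  set K := ⌈M / h⌉₊
  refine ⟨(Fintype.piFinset fun _ : Fin d => Finset.Icc (-(K : ℤ)) K).image
    fun k => WithLp.toLp 2 fun j => h * (k j : ℝ), ?_, fun u hu => ?_⟩
  · refine Finset.card_image_le.trans ?_
    rw [Fintype.card_piFinset]
    simp only [Int.card_Icc, Finset.prod_const, Finset.card_univ, Fintype.card_fin]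
    gcongr
    omega
  · refine ⟨WithLp.toLp 2 fun j => h * (⌊u j / h⌋ : ℝ), Finset.mem_image.2
      ⟨fun j => ⌊u j / h⌋, ?_, rfl⟩, ?_⟩
    · rw [Fintype.mem_piFinset]
      intro j
      have h1 : |u j| ≤ M := by
        simpa using (PiLp.norm_apply_le u j).trans hu
      have h2 : M / h ≤ K := Nat.le_ceil _
      have h3 := abs_le.1 h1
      have h4 : u j / h ≤ K := (div_le_div_of_nonneg_right h3.2 hh.le).trans h2
      have h5 : -(K : ℝ) ≤ u j / h := by
        have : -(M / h) ≤ u j / h := by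
          rw [← neg_div]; exact div_le_div_of_nonneg_right h3.1 hh.le
        linarith
      rw [Finset.mem_Icc]
      constructor
      · apply Int.le_floor.2; push_cast; exact h5
      · have : (⌊u j / h⌋ : ℝ) ≤ K := (Int.floor_le _).trans h4
        exact_mod_cast this
    · have hc : ∀ j, (u j - h * (⌊u j / h⌋ : ℝ)) ^ 2 ≤ h ^ 2 := by
        intro j
        have h1 := Int.floor_le (u j / h)
        have h2 := (Int.lt_floor_add_one (u j / h)).le
        rw [le_div_iff₀ hh] at h1
        rw [div_le_iff₀ hh] at h2
        apply pow_le_pow_left₀ <;> nlinarith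
      have : ‖u - WithLp.toLp 2 fun j => h * (⌊u j / h⌋ : ℝ)‖ ^ 2 ≤ (d * h) ^ 2 := by
        rw [EuclideanSpace.real_norm_sq_eq]
        calc _ ≤ ∑ j : Fin d, h ^ 2 := Finset.sum_le_sum fun j _ => by simpa using hc j
          _ = d * h ^ 2 := by simp
          _ ≤ (d * h) ^ 2 := by
            rcases Nat.eq_zero_or_pos d with rfl | hd
            · simp
            · have : (1 : ℝ) ≤ d := by exact_mod_cast hd
              rw [mul_pow]; gcongr; nlinarith
      exact le_of_sq_le_sq this (by positivity)

/-! ### Moment generating function of one normalized summand. -/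

lemma exp_le_one_add_add_sq_mul_exp_abs (x : ℝ) :
    Real.exp x ≤ 1 + x + x ^ 2 * Real.exp |x| := by
  rcases le_total 0 x with h | h
  · rw [abs_of_nonneg h]
    have h1 := Real.add_one_le_exp (-x)
    have h2 : Real.exp (-x) * Real.exp x = 1 := by rw [← Real.exp_add]; simp
    have h3 : Real.exp x - 1 ≤ x * Real.exp x := by nlinarith [Real.exp_pos x]
    nlinarith
  · rw [abs_of_nonpos h]
    have h1 := Real.add_one_le_exp (-x)
    have h2 : Real.exp (-x) * Real.exp x = 1 := by rw [← Real.exp_add]; simp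
    have h3 : Real.exp x * (1 - x) ≤ 1 := by nlinarith [Real.exp_pos x]
    have h4 : Real.exp x ≤ 1 + x + x ^ 2 := by
      by_contra! h5
      have : (1 + x + x ^ 2) * (1 - x) < 1 := by nlinarith
      nlinarith [mul_nonneg (neg_nonneg.2 h) (sq_nonneg x)]
    nlinarith [sq_nonneg x]

lemma integral_cos_gaussianReal (a : ℝ) :
    ∫ z, Real.cos (a * z) ∂(gaussianReal 0 1) = Real.exp (-a ^ 2 / 2) := by
  have h := charFun_gaussianReal (μ := 0) (v := 1) a
  rw [charFun_apply_real] at h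
  have hi : Integrable (fun z : ℝ => Complex.exp (a * z * Complex.I)) (gaussianReal 0 1) := by
    refine Integrable.of_bound (by fun_prop) 1 (ae_of_all _ fun z => ?_)
    rw [← Complex.ofReal_mul, Complex.norm_exp_ofReal_mul_I]
  have h2 := integral_re hi
  rw [h] at h2
  have h3 : ∀ z : ℝ, RCLike.re (Complex.exp (a * z * Complex.I)) = Real.cos (a * z) := by
    intro z
    rw [← Complex.ofReal_mul]
    exact Complex.exp_ofReal_mul_I_re _
  simp_rw [h3] at h2
  rw [h2]
  have : (a * (0 : ℝ) * Complex.I - (1 : NNReal) * a ^ 2 / 2 : ℂ) = ((-a ^ 2 / 2 : ℝ) : ℂ) := by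
    push_cast; simp; ring
  rw [this, ← Complex.ofReal_exp]
  rfl

lemma integrable_exp_sq_div_four_gaussianReal :
    Integrable (fun z : ℝ => Real.exp (z ^ 2 / 4)) (gaussianReal 0 1) := by
  rw [gaussianReal_of_var_ne_zero _ one_ne_zero,
    integrable_withDensity_iff_integrable_smul' (measurable_gaussianPDF _ _)
      (ae_of_all _ fun _ => gaussianPDF_lt_top)]
  have h := (integrable_exp_neg_mul_sq (b := 1 / 4) (by norm_num)).const_mul
    ((√(2 * Real.pi * (1 : NNReal)))⁻¹)
  refine h.congr (ae_of_all _ fun z => ?_)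
  simp only [toReal_gaussianPDF, gaussianPDFReal, smul_eq_mul]
  rw [mul_assoc (√_)⁻¹, ← Real.exp_add]
  congr 2
  simp
  ring

/-- The normalized and centred summand, as a function of a standard Gaussian variable. -/
noncomputable def centredCos (a z : ℝ) : ℝ := (1 - Real.cos (a * z)) / gaussianDefect a - 1

lemma continuous_centredCos (a : ℝ) : Continuous (centredCos a) := by
  unfold centredCos; fun_prop

/-- The bound is uniform in `a`: for `a ≤ 1`, `1 - cos (a z) ≤ a² z² / 2` and `a² ≤ 4 gaussianDefect
a` give `2 z²`; for `a ≥ 1`, the numerator is at most `2` and the defect at least `1/4`, giving `8`.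
-/
lemma abs_centredCos_le {a : ℝ} (ha : 0 < a) (z : ℝ) : |centredCos a z| ≤ 8 + 2 * z ^ 2 := by
  have hk := gaussianDefect_pos ha
  have h0 : 0 ≤ (1 - Real.cos (a * z)) / gaussianDefect a :=
    div_nonneg (by linarith [Real.cos_le_one (a * z)]) hk.le
  have h1 : (1 - Real.cos (a * z)) / gaussianDefect a ≤ 8 + 2 * z ^ 2 := by
    rw [div_le_iff₀ hk]
    rcases le_total a 1 with h | h
    · have h2 := Real.one_sub_sq_div_two_le_cos (x := a * z)
      have h3 := mul_le_mul_of_nonneg_right (sq_le_four_mul_gaussianDefect ha.le h) (sq_nonneg z)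
      nlinarith
    · have h2 := sq_le_four_mul_gaussianDefect zero_le_one le_rfl
      have h3 := gaussianDefect_mono zero_le_one h
      nlinarith [Real.neg_one_le_cos (a * z), mul_nonneg (sq_nonneg z) hk.le]
  unfold centredCos
  rw [abs_le]
  constructor <;> nlinarith [sq_nonneg z]

/-- This bound degenerates as `a → 0` and serves only for integrability. -/
lemma abs_centredCos_le_const {a : ℝ} (ha : 0 < a) (z : ℝ) :
    |centredCos a z| ≤ 2 / gaussianDefect a + 1 := by
  have hk := gaussianDefect_pos ha
  have h0 : 0 ≤ (1 - Real.cos (a * z)) / gaussianDefect a :=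
    div_nonneg (by linarith [Real.cos_le_one (a * z)]) hk.le
  have h1 : (1 - Real.cos (a * z)) / gaussianDefect a ≤ 2 / gaussianDefect a := by
    gcongr; linarith [Real.neg_one_le_cos (a * z)]
  unfold centredCos
  rw [abs_le]
  constructor <;> linarith

lemma integrable_centredCos {a : ℝ} (ha : 0 < a) :
    Integrable (centredCos a) (gaussianReal 0 1) :=
  Integrable.of_bound (continuous_centredCos a).aestronglyMeasurable _
    (ae_of_all _ (abs_centredCos_le_const ha))

lemma integral_centredCos {a : ℝ} (ha : 0 < a) :
    ∫ z, centredCos a z ∂(gaussianReal 0 1) = 0 := by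
  have hc : Integrable (fun z => Real.cos (a * z)) (gaussianReal 0 1) :=
    Integrable.of_bound (by fun_prop) 1 (ae_of_all _ fun z => Real.abs_cos_le_one _)
  unfold centredCos
  have hc' : Integrable (fun z => (1 - Real.cos (a * z)) / gaussianDefect a) (gaussianReal 0 1) :=
    ((integrable_const 1).sub hc).div_const _
  rw [integral_sub hc' (integrable_const 1),
    integral_div, integral_sub (integrable_const 1) hc, integral_cos_gaussianReal]
  have hk := gaussianDefect_pos ha
  simp only [integral_const, probReal_univ, smul_eq_mul, mul_one]
  change gaussianDefect a / gaussianDefect a - 1 = 0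
  rw [div_self hk.ne', sub_self]

lemma integrable_exp_mul_centredCos {a : ℝ} (ha : 0 < a) (l : ℝ) :
    Integrable (fun z => Real.exp (l * centredCos a z)) (gaussianReal 0 1) := by
  have := continuous_centredCos a
  refine Integrable.of_bound (by fun_prop) (Real.exp (|l| * (2 / gaussianDefect a + 1)))
    (ae_of_all _ fun z => ?_)
  rw [Real.norm_of_nonneg (Real.exp_pos _).le]
  apply Real.exp_le_exp.2
  refine (le_abs_self _).trans ?_
  rw [abs_mul]
  gcongr
  exact abs_centredCos_le_const ha z

/-- The linear term integrates to zero. The remainder `l² Y² exp |l Y|` is dominated, uniformly in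
`a`, by `l²` times a multiple of `exp (z² / 4)`, which is Gaussian-integrable. -/
lemma exists_integral_exp_mul_centredCos_le :
    ∃ B : ℝ, 1 ≤ B ∧ ∀ a l : ℝ, 0 < a → |l| ≤ 1 / 16 →
      ∫ z, Real.exp (l * centredCos a z) ∂(gaussianReal 0 1) ≤ Real.exp (B * l ^ 2) := by
  set J := ∫ z, 512 * Real.exp 1 * Real.exp (z ^ 2 / 4) ∂(gaussianReal 0 1) with hJ
  have hJ0 : 0 ≤ J := integral_nonneg fun z => by positivity
  refine ⟨1 + J, by linarith, fun a l ha hl => ?_⟩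
  have hpt : ∀ z, Real.exp (l * centredCos a z) ≤
      1 + l * centredCos a z + l ^ 2 * (512 * Real.exp 1 * Real.exp (z ^ 2 / 4)) := by
    intro z
    refine (exp_le_one_add_add_sq_mul_exp_abs _).trans ?_
    have hY := abs_centredCos_le ha z
    set Y := centredCos a z
    have h1 : Real.exp |l * Y| ≤ Real.exp ((8 + 2 * z ^ 2) / 16) := by
      apply Real.exp_le_exp.2
      rw [abs_mul]
      nlinarith [abs_nonneg l, abs_nonneg Y]
    -- With `x = (8 + 2 z²) / 16`, `Y² ≤ 256 x²` and `x² / 2 ≤ exp x`.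
    have h2 : Y ^ 2 ≤ 512 * Real.exp ((8 + 2 * z ^ 2) / 16) := by
      have h3 := Real.quadratic_le_exp_of_nonneg (x := (8 + 2 * z ^ 2) / 16) (by positivity)
      have h4 : Y ^ 2 ≤ (8 + 2 * z ^ 2) ^ 2 := by rw [← sq_abs]; gcongr
      nlinarith
    have h5 : Real.exp ((8 + 2 * z ^ 2) / 16) * Real.exp ((8 + 2 * z ^ 2) / 16) =
        Real.exp 1 * Real.exp (z ^ 2 / 4) := by
      rw [← Real.exp_add, ← Real.exp_add]; congr 1; ring
    have h6 : Y ^ 2 * Real.exp |l * Y| ≤ 512 * Real.exp 1 * Real.exp (z ^ 2 / 4) := by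
      calc _ ≤ 512 * Real.exp ((8 + 2 * z ^ 2) / 16) * Real.exp ((8 + 2 * z ^ 2) / 16) := by
            gcongr
        _ = _ := by rw [mul_assoc, h5]; ring
    have := mul_le_mul_of_nonneg_left h6 (sq_nonneg l)
    rw [mul_pow]
    linarith
  have i1 := (integrable_const (1 : ℝ)).add ((integrable_centredCos ha).const_mul l)
  have i2 := (integrable_exp_sq_div_four_gaussianReal.const_mul (512 * Real.exp 1)).const_mul
    (l ^ 2)
  have h := integral_mono (integrable_exp_mul_centredCos ha l) (i1.add i2) hpt
  simp only [Pi.add_apply] at h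
  rw [integral_add (by simpa using i1) i2, integral_add (integrable_const _)
    ((integrable_centredCos ha).const_mul l), integral_const_mul, integral_centredCos ha,
    integral_const_mul, ← hJ] at h
  simp only [integral_const, probReal_univ, smul_eq_mul] at h
  have := Real.add_one_le_exp ((1 + J) * l ^ 2)
  nlinarith [sq_nonneg l]

/-! ### Concentration at a fixed vector. -/

section vectors

variable {Ω E : Type*} [MeasurableSpace Ω] {P : Measure Ω}
  [NormedAddCommGroup E] [InnerProductSpace ℝ E] [FiniteDimensional ℝ E]
  [MeasurableSpace E] [BorelSpace E]

/-- The one-dimensional marginals of a standard Gaussian vector. -/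
lemma map_inner_stdGaussian (u : E) :
    (stdGaussian E).map (fun x => inner ℝ x u) = (gaussianReal 0 1).map (fun z => ‖u‖ * z) := by
  have h : (fun x : E => inner ℝ x u) = innerSL ℝ u := by
    ext x; simp [real_inner_comm]
  rw [h, IsGaussian.map_eq_gaussianReal, integral_strongDual_stdGaussian,
    variance_dual_stdGaussian, gaussianReal_map_const_mul]
  congr 1
  · simp
  · ext; simp

lemma integral_comp_inner_of_hasLaw {X : Ω → E} (hX : HasLaw X (stdGaussian E) P) (u : E)
    {f : ℝ → ℝ} (hf : Measurable f) :
    ∫ ω, f (inner ℝ (X ω) u) ∂P = ∫ z, f (‖u‖ * z) ∂(gaussianReal 0 1) := by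
  have h1 := hX.integral_comp (f := fun x => f (inner ℝ x u))
    (by fun_prop : Measurable _).aestronglyMeasurable
  have h2 : ∫ y, f y ∂((stdGaussian E).map fun x => inner ℝ x u) =
      ∫ x, f (inner ℝ x u) ∂(stdGaussian E) :=
    integral_map (by fun_prop) hf.aestronglyMeasurable
  rw [map_inner_stdGaussian, integral_map (by fun_prop) hf.aestronglyMeasurable] at h2
  rw [h2, ← h1]
  rfl

lemma exists_measureReal_cosDefect_le : ∃ c : ℝ, 0 < c ∧ c ≤ 1 ∧
    ∀ {Ω E : Type*} [MeasurableSpace Ω] (P : Measure Ω) [IsProbabilityMeasure P]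
      [NormedAddCommGroup E] [InnerProductSpace ℝ E] [FiniteDimensional ℝ E]
      [MeasurableSpace E] [BorelSpace E] {t : ℕ} (g : Fin t → Ω → E), 0 < t → iIndepFun g P →
      (∀ i, HasLaw (g i) (stdGaussian E) P) → ∀ (u : E) (ε : ℝ), 0 < ε → ε < 1 →
      P.real {ω | ¬ |cosDefect (fun i => g i ω) u - gaussianDefect ‖u‖| ≤
        ε / 4 * gaussianDefect ‖u‖} ≤ 2 * Real.exp (-(c * t * ε ^ 2)) := by
  obtain ⟨B, hB1, hB⟩ := exists_integral_exp_mul_centredCos_le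
  refine ⟨1 / (128 * B), by positivity, ?_, ?_⟩
  · rw [div_le_one (by positivity)]; linarith
  intro Ω E _ P _ _ _ _ _ _ t g ht hind hlaw u ε hε hε1
  rcases eq_or_ne u 0 with rfl | hu
  · simp [cosDefect, gaussianDefect]
    positivity
  have ha : 0 < ‖u‖ := norm_pos_iff.2 hu
  have hk := gaussianDefect_pos ha
  have ht' : (0 : ℝ) < t := by exact_mod_cast ht
  set f : ℝ → ℝ := fun y => (1 - Real.cos y) / gaussianDefect ‖u‖ - 1 with hf
  have hfm : Measurable f := by fun_prop
  set X : Fin t → Ω → ℝ := fun i ω => f (inner ℝ (g i ω) u) with hX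
  have hXi : iIndepFun X P := hind.comp (fun _ x => f (inner ℝ x u)) (fun _ => by fun_prop)
  have hXm : ∀ i, AEMeasurable (X i) P := fun i =>
    (by fun_prop : Measurable fun x : E => f (inner ℝ x u)).comp_aemeasurable (hlaw i).aemeasurable
  have hmgf : ∀ l : ℝ, |l| ≤ 1 / 16 → mgf (∑ i, X i) P l ≤ Real.exp (t * (B * l ^ 2)) := by
    intro l hl
    rw [hXi.mgf_sum₀ hXm]
    calc _ ≤ ∏ i : Fin t, Real.exp (B * l ^ 2) := by
          apply Finset.prod_le_prod (fun i _ => mgf_nonneg) (fun i _ => ?_)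
          refine le_trans (le_of_eq ?_) (hB ‖u‖ l ha hl)
          exact integral_comp_inner_of_hasLaw (hlaw i) u (f := fun y => Real.exp (l * f y))
            (by fun_prop)
      _ = _ := by rw [Finset.prod_const, ← Real.exp_nat_mul]; simp
  have hbound : ∀ ω, |∑ i, X i ω| ≤ t * (2 / gaussianDefect ‖u‖ + 1) := by
    intro ω
    refine (Finset.abs_sum_le_sum_abs _ _).trans ?_
    refine (Finset.sum_le_card_nsmul _ _ (2 / gaussianDefect ‖u‖ + 1) fun i _ => ?_).trans ?_
    · have := abs_centredCos_le_const ha (inner ℝ (g i ω) u / ‖u‖)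
      rwa [centredCos, mul_div_cancel₀ _ ha.ne'] at this
    · simp [mul_add]
  have hint : ∀ l : ℝ, Integrable (fun ω => Real.exp (l * (∑ i, X i) ω)) P := by
    intro l
    have hm : AEMeasurable (∑ i, X i) P := Finset.aemeasurable_sum _ fun i _ => hXm i
    refine Integrable.of_bound (by fun_prop)
      (Real.exp (|l| * (t * (2 / gaussianDefect ‖u‖ + 1)))) (ae_of_all _ fun ω => ?_)
    rw [Real.norm_of_nonneg (Real.exp_pos _).le]
    apply Real.exp_le_exp.2
    refine (le_abs_self _).trans ?_
    rw [abs_mul, Finset.sum_apply]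
    gcongr
    exact hbound ω
  -- Half the optimal Chernoff parameter `ε / (8 B)`, so that `|l| ≤ 1 / 16` for every `ε < 1`.
  set l := ε / (16 * B) with hl
  have hl0 : 0 < l := by positivity
  have hl1 : |l| ≤ 1 / 16 := by
    rw [abs_of_pos hl0, hl, div_le_iff₀ (by positivity)]; nlinarith
  have hexp : Real.exp (-l * (t * (ε / 4))) * Real.exp (t * (B * l ^ 2)) ≤
      Real.exp (-(1 / (128 * B) * t * ε ^ 2)) := by
    rw [← Real.exp_add]
    apply Real.exp_le_exp.2
    have : -l * (t * (ε / 4)) + t * (B * l ^ 2) = -(3 / (256 * B) * t * ε ^ 2) := by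
      rw [hl]; field_simp; ring
    rw [this, neg_le_neg_iff]
    gcongr ?_ * _ * _
    rw [div_le_div_iff₀ (by positivity) (by positivity)]
    linarith
  have hup : P.real {ω | t * (ε / 4) ≤ (∑ i, X i) ω} ≤ Real.exp (-(1 / (128 * B) * t * ε ^ 2)) :=
    (measure_ge_le_exp_mul_mgf _ hl0.le (hint l)).trans
      ((mul_le_mul_of_nonneg_left (hmgf l hl1) (Real.exp_pos _).le).trans hexp)
  have hlo : P.real {ω | (∑ i, X i) ω ≤ -(t * (ε / 4))} ≤
      Real.exp (-(1 / (128 * B) * t * ε ^ 2)) := by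
    refine (measure_le_le_exp_mul_mgf _ (neg_nonpos.2 hl0.le) (hint (-l))).trans
      ((mul_le_mul_of_nonneg_left (hmgf (-l) (by rwa [abs_neg])) (Real.exp_pos _).le).trans ?_)
    rw [neg_sq, neg_mul_neg]
    exact hexp
  have hsub : {ω | ¬ |cosDefect (fun i => g i ω) u - gaussianDefect ‖u‖| ≤
      ε / 4 * gaussianDefect ‖u‖} ⊆
      {ω | t * (ε / 4) ≤ (∑ i, X i) ω} ∪ {ω | (∑ i, X i) ω ≤ -(t * (ε / 4))} := by
    intro ω hω
    by_contra hcon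
    simp only [Set.mem_union, Set.mem_ofPred_eq, not_or, not_le, Finset.sum_apply] at hcon
    apply hω
    have heq : cosDefect (fun i => g i ω) u - gaussianDefect ‖u‖ =
        gaussianDefect ‖u‖ / t * ∑ i, X i ω := by
      simp only [cosDefect, hX, hf, Finset.sum_sub_distrib, ← Finset.sum_div]
      simp only [Finset.sum_const, Finset.card_univ, Fintype.card_fin, nsmul_eq_mul, mul_one]
      field_simp
    rw [heq, abs_mul, abs_of_pos (by positivity)]
    calc _ ≤ gaussianDefect ‖u‖ / t * (t * (ε / 4)) := by
          gcongr
          exact abs_le.2 ⟨hcon.2.le, hcon.1.le⟩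
      _ = _ := by field_simp
  calc _ ≤ _ := measureReal_mono hsub
    _ ≤ _ := measureReal_union_le _ _
    _ ≤ _ := by linarith

end vectors

/-! ### Fourth moments of the frequencies. -/

/-- Cauchy–Schwarz gives `‖x‖ ^ 4 ≤ d * ∑ j, x j ^ 4`, and each coordinate is a standard real
Gaussian. -/
lemma exists_integral_norm_pow_four_le : ∃ B : ℝ, 1 ≤ B ∧ ∀ d : ℕ,
    Integrable (fun x => ‖x‖ ^ 4) (stdGaussian (EuclideanSpace ℝ (Fin d))) ∧
    ∫ x, ‖x‖ ^ 4 ∂(stdGaussian (EuclideanSpace ℝ (Fin d))) ≤ B * d ^ 2 := by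
  have hz : Integrable (fun z : ℝ => z ^ 4) (gaussianReal 0 1) := by
    have := (memLp_id_gaussianReal' (μ := 0) (v := 1) 4 (by simp)).integrable_norm_pow (p := 4)
      (by norm_num)
    refine this.congr (ae_of_all _ fun z => ?_)
    simp only [id, Real.norm_eq_abs]
    rw [← abs_pow, abs_of_nonneg (by positivity)]
  have hJ0 : 0 ≤ ∫ z, z ^ 4 ∂(gaussianReal 0 1) := integral_nonneg fun z => by positivity
  refine ⟨1 + ∫ z, z ^ 4 ∂(gaussianReal 0 1), by linarith, fun d => ?_⟩
  have hcoord : ∀ j : Fin d, (fun x : EuclideanSpace ℝ (Fin d) => x j ^ 4) =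
      (fun z : ℝ => z ^ 4) ∘ fun x => inner ℝ x (EuclideanSpace.single j (1 : ℝ)) := by
    intro j; ext x; simp [EuclideanSpace.inner_single_right]
  have hmap : ∀ j : Fin d, (stdGaussian (EuclideanSpace ℝ (Fin d))).map
      (fun x => inner ℝ x (EuclideanSpace.single j (1 : ℝ))) = gaussianReal 0 1 := by
    intro j
    rw [map_inner_stdGaussian]
    simp
  have hint : ∀ j : Fin d, Integrable (fun x : EuclideanSpace ℝ (Fin d) => x j ^ 4)
      (stdGaussian (EuclideanSpace ℝ (Fin d))) := by
    intro j
    rw [hcoord, ← integrable_map_measure (by fun_prop) (by fun_prop), hmap]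
    exact hz
  have hval : ∀ j : Fin d, ∫ x : EuclideanSpace ℝ (Fin d), x j ^ 4
      ∂(stdGaussian (EuclideanSpace ℝ (Fin d))) = ∫ z, z ^ 4 ∂(gaussianReal 0 1) := by
    intro j
    rw [← hmap j, integral_map (by fun_prop) (by fun_prop)]
    congr 1
    exact hcoord j
  have hle : ∀ x : EuclideanSpace ℝ (Fin d), ‖x‖ ^ 4 ≤ d * ∑ j, x j ^ 4 := by
    intro x
    have h := sq_sum_le_card_mul_sum_sq (s := Finset.univ) (f := fun j => x j ^ 2)
    rw [← EuclideanSpace.real_norm_sq_eq] at h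
    simp only [← pow_mul] at h
    simpa using h
  have hS : Integrable (fun x : EuclideanSpace ℝ (Fin d) => d * ∑ j, x j ^ 4)
      (stdGaussian (EuclideanSpace ℝ (Fin d))) :=
    (integrable_finsetSum _ fun j _ => hint j).const_mul _
  have hN : Integrable (fun x => ‖x‖ ^ 4) (stdGaussian (EuclideanSpace ℝ (Fin d))) := by
    refine hS.mono' (by fun_prop) (ae_of_all _ fun x => ?_)
    rw [Real.norm_of_nonneg (by positivity)]
    exact hle x
  refine ⟨hN, (integral_mono hN hS hle).trans ?_⟩
  rw [integral_const_mul, integral_finsetSum _ fun j _ => hint j]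
  simp only [hval, Finset.sum_const, Finset.card_univ, Fintype.card_fin, nsmul_eq_mul]
  nlinarith [sq_nonneg (d : ℝ)]

lemma measureReal_avg_norm_pow_four_le {Ω : Type*} [MeasurableSpace Ω] {P : Measure Ω}
    [IsProbabilityMeasure P] {d t : ℕ} {B δ : ℝ} (hB : 0 < B) (hd : 0 < d) (ht : 0 < t)
    (hδ : 0 < δ)
    (hint : Integrable (fun x => ‖x‖ ^ 4) (stdGaussian (EuclideanSpace ℝ (Fin d))))
    (hle : ∫ x, ‖x‖ ^ 4 ∂(stdGaussian (EuclideanSpace ℝ (Fin d))) ≤ B * d ^ 2)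
    {g : Fin t → Ω → EuclideanSpace ℝ (Fin d)} (hlaw : ∀ i, HasLaw (g i) (stdGaussian _) P) :
    P.real {ω | 2 * B * d ^ 2 / δ ≤ (∑ i, ‖g i ω‖ ^ 4) / t} ≤ δ / 2 := by
  have ht' : (0 : ℝ) < t := by exact_mod_cast ht
  have hd' : (0 : ℝ) < d := by exact_mod_cast hd
  have hi : ∀ i, Integrable (fun ω => ‖g i ω‖ ^ 4) P := fun i => by
    have h := hint
    rw [← (hlaw i).map_eq, integrable_map_measure (by fun_prop) (hlaw i).aemeasurable] at h
    exact h
  have hv : ∀ i, ∫ ω, ‖g i ω‖ ^ 4 ∂P ≤ B * d ^ 2 := fun i => by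
    have h := (hlaw i).integral_comp (f := fun x => ‖x‖ ^ 4) (by fun_prop)
    exact h.trans_le hle
  have h := mul_meas_ge_le_integral_of_nonneg (μ := P)
    (f := fun ω => (∑ i, ‖g i ω‖ ^ 4) / t) (ae_of_all _ fun ω => by positivity)
    ((integrable_finsetSum _ fun i _ => hi i).div_const _) (2 * B * d ^ 2 / δ)
  rw [integral_div, integral_finsetSum _ fun i _ => hi i] at h
  have h2 : (∑ i, ∫ ω, ‖g i ω‖ ^ 4 ∂P) / t ≤ B * d ^ 2 := by
    rw [div_le_iff₀ ht']
    refine (Finset.sum_le_card_nsmul _ _ _ fun i _ => hv i).trans (le_of_eq ?_)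
    simp; ring
  have h3 := h.trans h2
  rw [← le_div_iff₀' (by positivity)] at h3
  refine h3.trans (le_of_eq ?_)
  field_simp

/-! ### Union bound over the net. -/

lemma card_net_mul_exp_le {d t : ℕ} {B c ε δ M η R : ℝ} (hd : 1 ≤ d) (hB : 1 ≤ B)
    (hc : 0 < c) (hε : 0 < ε) (hε1 : ε < 1) (hδ : 0 < δ) (hδ1 : δ < 1) (hM : 1 ≤ M)
    (hR : R = 2 * B * d ^ 2 / δ) (hη : η = ε * (ε / (8 * (R + 1))) / (16 * (R + 3)))
    (ht : (Real.log (4 * (20480 * B ^ 2)) + 6) / c * (d / ε ^ 2) *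
      (1 + Real.log (d / ε * (M / δ))) ≤ t) :
    ((2 * ⌈M / (η / d)⌉₊ + 1 : ℕ) : ℝ) ^ d * (2 * Real.exp (-(c * t * ε ^ 2))) ≤ δ / 2 := by
  have hd' : (1 : ℝ) ≤ d := by exact_mod_cast hd
  have hR1 : 1 ≤ R := by
    rw [hR, le_div_iff₀ hδ]
    nlinarith [mul_le_mul hB (one_le_pow₀ hd' : (1 : ℝ) ≤ d ^ 2) zero_le_one (by linarith)]
  have hη' : η = ε ^ 2 / (128 * (R + 1) * (R + 3)) := by rw [hη]; field_simp; norm_num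
  have hη0 : 0 < η := by rw [hη']; positivity
  have hηlow : ε ^ 2 / (1024 * R ^ 2) ≤ η := by
    rw [hη']
    apply div_le_div_of_nonneg_left (by positivity) (by positivity)
    nlinarith
  have hη1 : η ≤ 1 := by
    rw [hη', div_le_one (by positivity)]
    nlinarith
  set Q := d / ε * (M / δ) with hQ
  have hinvε : 1 ≤ 1 / ε := by rw [le_div_iff₀ hε]; linarith
  have hinvδ : 1 ≤ 1 / δ := by rw [le_div_iff₀ hδ]; linarith
  have hQe : Q = d * M * (1 / ε) * (1 / δ) := by rw [hQ]; field_simp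
  have hQδ : 1 / δ ≤ Q := by
    rw [hQe]
    exact le_mul_of_one_le_left (by positivity)
      (one_le_mul_of_one_le_of_one_le (one_le_mul_of_one_le_of_one_le hd' hM) hinvε)
  have hQ1 : 1 ≤ Q := hinvδ.trans hQδ
  -- The exponent `5` comes from `d`: the grid step contributes `d`, and `1 / η ≲ R² / ε²`
  -- contributes `d⁴`.
  have hA : ((2 * ⌈M / (η / d)⌉₊ + 1 : ℕ) : ℝ) ≤ 20480 * B ^ 2 * Q ^ 5 := by
    have h1 : M / (η / d) = M * d / η := by field_simp
    have h2 : 1 ≤ M * d / η := by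
      rw [le_div_iff₀ hη0]; nlinarith
    have h3 : (⌈M / (η / d)⌉₊ : ℝ) ≤ M * d / η + 1 := by
      rw [h1]; exact (Nat.ceil_lt_add_one (by positivity)).le
    have h4 : M * d / η ≤ M * d / (ε ^ 2 / (1024 * R ^ 2)) := by gcongr
    have h5 : M * d / (ε ^ 2 / (1024 * R ^ 2)) =
        4096 * B ^ 2 * (d ^ 5 * M * (1 / ε) ^ 2 * (1 / δ) ^ 2) := by
      rw [hR]; field_simp; norm_num
    have h6 : d ^ 5 * M * (1 / ε) ^ 2 * (1 / δ) ^ 2 ≤ Q ^ 5 := by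
      rw [hQe, mul_pow, mul_pow, mul_pow]
      gcongr ?_ * ?_ * ?_ * ?_
      · exact le_self_pow₀ hM (by norm_num)
      · exact pow_le_pow_right₀ hinvε (by norm_num)
      · exact pow_le_pow_right₀ hinvδ (by norm_num)
    have h7 := mul_le_mul_of_nonneg_left h6 (show 0 ≤ 4096 * B ^ 2 by positivity)
    push_cast
    linarith
  have hlogQ : 0 ≤ Real.log Q := Real.log_nonneg hQ1
  have hlogA : 0 ≤ Real.log (4 * (20480 * B ^ 2)) := Real.log_nonneg (by nlinarith)
  have hexp : d * (Real.log (4 * (20480 * B ^ 2)) + 6 * Real.log Q) ≤ c * t * ε ^ 2 := by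
    have h1 : c * ((Real.log (4 * (20480 * B ^ 2)) + 6) / c * (d / ε ^ 2) * (1 + Real.log Q)) *
        ε ^ 2 ≤ c * t * ε ^ 2 := by gcongr
    refine le_trans ?_ h1
    have h2 : c * ((Real.log (4 * (20480 * B ^ 2)) + 6) / c * (d / ε ^ 2) * (1 + Real.log Q)) *
        ε ^ 2 = d * ((Real.log (4 * (20480 * B ^ 2)) + 6) * (1 + Real.log Q)) := by
      field_simp
    rw [h2]
    gcongr
    nlinarith
  have hpow : (4 * (20480 * B ^ 2) * Q ^ 6) ^ d ≤ Real.exp (c * t * ε ^ 2) := by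
    have : 4 * (20480 * B ^ 2) * Q ^ 6 =
        Real.exp (Real.log (4 * (20480 * B ^ 2)) + 6 * Real.log Q) := by
      rw [Real.exp_add, Real.exp_log (by positivity), mul_comm (6 : ℝ), Real.exp_mul,
        Real.exp_log (by positivity)]
      norm_cast
    rw [this, ← Real.exp_nat_mul]
    exact Real.exp_le_exp.2 hexp
  -- The target probability is absorbed into the `d`-th power, raising `Q ^ 5` to `Q ^ 6`; hence the
  -- `6` in the condition on `t`.
  have h4 : 4 * (1 / δ) ≤ (4 * Q) ^ d :=
    (by linarith : 4 * (1 / δ) ≤ 4 * Q).trans (le_self_pow₀ (by linarith) (by omega))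
  have hfin : ((2 * ⌈M / (η / d)⌉₊ + 1 : ℕ) : ℝ) ^ d * (4 * (1 / δ)) ≤
      Real.exp (c * t * ε ^ 2) :=
    calc _ ≤ (20480 * B ^ 2 * Q ^ 5) ^ d * (4 * Q) ^ d := by gcongr
      _ = (4 * (20480 * B ^ 2) * Q ^ 6) ^ d := by rw [← mul_pow]; congr 1; ring
      _ ≤ _ := hpow
  rw [Real.exp_neg, ← mul_assoc, ← div_eq_mul_inv, div_le_iff₀ (Real.exp_pos _)]
  have h5 := mul_le_mul_of_nonneg_left hfin (show 0 ≤ δ / 2 by positivity)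
  refine le_trans (le_of_eq ?_) h5
  field_simp
  ring

/-- Uniform relative concentration, with an additive constant next to the logarithm. -/
lemma exists_measureReal_uniform_le : ∃ C : ℝ, 0 < C ∧
    ∀ {Ω : Type*} [MeasurableSpace Ω] (P : Measure Ω) [IsProbabilityMeasure P] (d t : ℕ)
      (ε δ M : ℝ) (g : Fin t → Ω → EuclideanSpace ℝ (Fin d)),
      1 ≤ d → 0 < ε → ε < 1 → 0 < δ → δ < 1 → 1 ≤ M → 0 < t →
      C * (d / ε ^ 2) * (1 + Real.log (d / ε * (M / δ))) ≤ t → iIndepFun g P →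
      (∀ i, HasLaw (g i) (stdGaussian _) P) →
      P.real {ω | ¬ ∀ u, ‖u‖ ≤ M → |cosDefect (fun i => g i ω) u - gaussianDefect ‖u‖| ≤
        ε * gaussianDefect ‖u‖} ≤ δ := by
  obtain ⟨c, hc0, -, hc⟩ := exists_measureReal_cosDefect_le
  obtain ⟨B, hB1, hB⟩ := exists_integral_norm_pow_four_le
  have hlogA : 0 ≤ Real.log (4 * (20480 * B ^ 2)) := Real.log_nonneg (by nlinarith)
  refine ⟨(Real.log (4 * (20480 * B ^ 2)) + 6) / c, by positivity, ?_⟩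
  intro Ω _ P _ d t ε δ M g hd hε hε1 hδ hδ1 hM ht hC hind hlaw
  set R := 2 * B * d ^ 2 / δ with hR
  have hR0 : 0 ≤ R := by positivity
  set r := √(ε / (8 * (R + 1)))
  have hr : r ^ 2 = ε / (8 * (R + 1)) := Real.sq_sqrt (by positivity)
  have hr0 : 0 < r := Real.sqrt_pos.2 (by positivity)
  set η := ε * (ε / (8 * (R + 1))) / (16 * (R + 3)) with hη
  have hη0 : 0 < η := by positivity
  have hd' : (0 : ℝ) < d := by exact_mod_cast hd
  obtain ⟨N, hcard, hN⟩ := exists_finset_covering (d := d) (h := η / d) (M := M) (by positivity)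
  rw [mul_div_cancel₀ _ hd'.ne'] at hN
  have hmom := measureReal_avg_norm_pow_four_le (by linarith) hd ht hδ (hB d).1 (hB d).2 hlaw
  have hsub : {ω | ¬ ∀ u, ‖u‖ ≤ M → |cosDefect (fun i => g i ω) u - gaussianDefect ‖u‖| ≤
        ε * gaussianDefect ‖u‖} ⊆
      {ω | R ≤ (∑ i, ‖g i ω‖ ^ 4) / t} ∪ ⋃ v ∈ N, {ω | ¬ |cosDefect (fun i => g i ω) v -
        gaussianDefect ‖v‖| ≤ ε / 4 * gaussianDefect ‖v‖} := by
    intro ω hω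
    by_contra hcon
    simp only [Set.mem_union, Set.mem_iUnion, Set.mem_ofPred_eq, not_or, not_exists,
      not_not] at hcon
    refine hω fun u hu => ?_
    exact abs_cosDefect_sub_gaussianDefect_le_of_net ht _ hR0 (not_le.1 hcon.1).le hε hε1 hr0 hr
      (by rw [hη, hr]) hM (N : Set _) (fun u hu => hN u hu) (fun v hv => hcon.2 v hv) u hu
  have hunion : P.real (⋃ v ∈ N, {ω | ¬ |cosDefect (fun i => g i ω) v -
        gaussianDefect ‖v‖| ≤ ε / 4 * gaussianDefect ‖v‖}) ≤ δ / 2 := by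
    refine (measureReal_biUnion_finset_le _ _).trans ?_
    refine (Finset.sum_le_card_nsmul _ _ _ fun v _ => hc P g ht hind hlaw v ε hε hε1).trans ?_
    rw [nsmul_eq_mul]
    refine le_trans ?_ (card_net_mul_exp_le hd hB1 hc0 hε hε1 hδ hδ1 hM hR hη hC)
    gcongr
    exact_mod_cast hcard
  calc _ ≤ _ := measureReal_mono hsub
    _ ≤ _ := measureReal_union_le _ _
    _ ≤ _ := by linarith

/-! ### Kernel distances as defects, and rescaling to standard Gaussians. -/

lemma kernelDist_gaussianKernel_sq {d : ℕ} {σ : ℝ} (hσ : 0 < σ)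
    (x y : EuclideanSpace ℝ (Fin d)) :
    kernelDist (gaussianKernel σ) x y ^ 2 = 2 * gaussianDefect ‖σ⁻¹ • (x - y)‖ := by
  have h : gaussianKernel σ x x + gaussianKernel σ y y - 2 * gaussianKernel σ x y =
      2 * gaussianDefect ‖σ⁻¹ • (x - y)‖ := by
    simp only [gaussianKernel, gaussianDefect, norm_smul, sub_self, norm_zero, norm_inv,
      Real.norm_of_nonneg hσ.le]
    have : -‖x - y‖ ^ 2 / (2 * σ ^ 2) = -(σ⁻¹ * ‖x - y‖) ^ 2 / 2 := by field_simp
    rw [this]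
    norm_num
    ring
  rw [kernelDist, h, Real.sq_sqrt]
  linarith [gaussianDefect_nonneg ‖σ⁻¹ • (x - y)‖]

lemma kernelDist_featureKernel_sq {d t : ℕ} {σ : ℝ} (hσ : 0 < σ)
    (w : Fin t → EuclideanSpace ℝ (Fin d)) (x y : EuclideanSpace ℝ (Fin d)) :
    kernelDist (featureKernel w) x y ^ 2 =
      2 * cosDefect (fun i => σ • w i) (σ⁻¹ • (x - y)) := by
  rw [kernelDist_featureKernel, EuclideanSpace.real_norm_sq_eq, Fintype.sum_prod_type, cosDefect,
    Finset.sum_div, Finset.mul_sum]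
  refine Finset.sum_congr rfl fun i _ => ?_
  rw [inner_smul_left, inner_smul_right, inner_sub_right]
  simp only [fourierFeatures, Fin.sum_univ_two, PiLp.sub_apply, Matrix.cons_val_zero,
    Matrix.cons_val_one, conj_trivial, mul_inv_cancel_left₀ hσ.ne', Real.cos_sub]
  rw [← sub_div, ← sub_div, div_pow, div_pow, Real.sq_sqrt (Nat.cast_nonneg t)]
  set a := inner ℝ (w i) x
  set b := inner ℝ (w i) y
  rw [← add_div, mul_div_assoc']
  congr 1
  linear_combination Real.sin_sq_add_cos_sq a + Real.sin_sq_add_cos_sq b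

lemma map_smul_multivariateGaussian {d : ℕ} {σ : ℝ} (hσ : 0 < σ) :
    (multivariateGaussian 0 ((σ ^ 2)⁻¹ • (1 : Matrix (Fin d) (Fin d) ℝ))).map (fun x => σ • x) =
      stdGaussian (EuclideanSpace ℝ (Fin d)) := by
  apply Measure.ext_of_charFun
  ext u
  have hS : ((σ ^ 2)⁻¹ • (1 : Matrix (Fin d) (Fin d) ℝ)).PosSemidef :=
    Matrix.PosSemidef.one.smul (by positivity)
  rw [charFun_map_smul, charFun_multivariateGaussian hS, charFun_stdGaussian]
  congr 1
  have : (σ • u).ofLp ⬝ᵥ ((σ ^ 2)⁻¹ • (1 : Matrix (Fin d) (Fin d) ℝ)).mulVec (σ • u).ofLp =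
      ‖u‖ ^ 2 := by
    rw [EuclideanSpace.real_norm_sq_eq]
    simp only [Matrix.smul_mulVec, Matrix.one_mulVec, dotProduct, PiLp.smul_apply, Pi.smul_apply,
      smul_eq_mul]
    refine Finset.sum_congr rfl fun j _ => ?_
    field_simp
  rw [this]
  simp
  ring

/-! ### The corner where the logarithm is small, and the final assembly. -/

/-- For such frequencies each summand separately meets the bound, so no averaging is needed. This
provides a good event of positive probability when `t` is small. -/
lemma abs_cosDefect_sub_gaussianDefect_le_of_mem_Icc {t : ℕ} (ht : 0 < t)
    (g : Fin t → EuclideanSpace ℝ (Fin 1)) (hg : ∀ i, g i 0 ∈ Set.Icc (1 / 2 : ℝ) (9 / 10))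
    (u : EuclideanSpace ℝ (Fin 1)) (hu : ‖u‖ ≤ 11 / 10) :
    |cosDefect g u - gaussianDefect ‖u‖| ≤ 9 / 10 * gaussianDefect ‖u‖ := by
  have ht' : (0 : ℝ) < t := by exact_mod_cast ht
  have hpt : ∀ i, |1 - Real.cos (inner ℝ (g i) u) - gaussianDefect ‖u‖| ≤
      9 / 10 * gaussianDefect ‖u‖ := by
    intro i
    have hx : inner ℝ (g i) u = g i 0 * u 0 := by
      simp [PiLp.inner_apply, mul_comm]
    have hn : ‖u‖ ^ 2 = u 0 ^ 2 := by rw [EuclideanSpace.real_norm_sq_eq]; simp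
    obtain ⟨h1, h2⟩ := hg i
    rw [hx]
    set s := g i 0
    set x := s * u 0 with hxs
    have hb : ‖u‖ ^ 2 ≤ 121 / 100 := by nlinarith [norm_nonneg u]
    have hs1 : 1 / 4 ≤ s ^ 2 := by nlinarith
    have hs2 : s ^ 2 ≤ 81 / 100 := by nlinarith
    have hx2 : x ^ 2 = s ^ 2 * ‖u‖ ^ 2 := by rw [hxs, mul_pow, hn]
    have hxl : ‖u‖ ^ 2 / 4 ≤ x ^ 2 := by rw [hx2]; nlinarith [sq_nonneg ‖u‖]
    have hxu : x ^ 2 ≤ 81 / 100 * ‖u‖ ^ 2 := by rw [hx2]; nlinarith [sq_nonneg ‖u‖]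
    have hx1 : x ^ 2 ≤ 1 := by linarith
    have hxa : |x| ≤ 1 := by rw [← sq_le_one_iff_abs_le_one]; exact hx1
    have hc1 := (abs_le.1 (Real.cos_bound hxa)).2
    have hc2 := Real.one_sub_sq_div_two_le_cos (x := x)
    have h4 : |x| ^ 4 ≤ x ^ 2 := by
      have : |x| ^ 4 = x ^ 2 * x ^ 2 := by rw [← sq_abs]; ring
      rw [this]; nlinarith [sq_nonneg x]
    have k1 := gaussianDefect_le ‖u‖
    have k2 := le_gaussianDefect_mul ‖u‖
    have k3 := mul_le_mul_of_nonneg_left hb (gaussianDefect_nonneg ‖u‖)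
    rw [abs_le]
    constructor <;> linarith
  have heq : cosDefect g u - gaussianDefect ‖u‖ =
      (∑ i, (1 - Real.cos (inner ℝ (g i) u) - gaussianDefect ‖u‖)) / t := by
    rw [Finset.sum_sub_distrib, sub_div]
    simp [cosDefect, ht'.ne']
  rw [heq]
  refine (abs_sum_div_le ht hpt).trans (le_of_eq ?_)
  simp
  field_simp

lemma measureReal_forall_mem_Icc_eq_pow {Ω : Type*} [MeasurableSpace Ω] {P : Measure Ω}
    [IsProbabilityMeasure P] {t : ℕ} {g : Fin t → Ω → EuclideanSpace ℝ (Fin 1)}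
    (hind : iIndepFun g P) (hlaw : ∀ i, HasLaw (g i) (stdGaussian _) P) {a b : ℝ} :
    P.real {ω | ∀ i, g i ω 0 ∈ Set.Icc a b} = (gaussianReal 0 1).real (Set.Icc a b) ^ t := by
  have hm : MeasurableSet {x : EuclideanSpace ℝ (Fin 1) | x 0 ∈ Set.Icc a b} :=
    (by fun_prop : Measurable fun x : EuclideanSpace ℝ (Fin 1) => x 0) measurableSet_Icc
  have h1 : stdGaussian (EuclideanSpace ℝ (Fin 1)) {x | x 0 ∈ Set.Icc a b} =
      gaussianReal 0 1 (Set.Icc a b) := by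
    have h := map_inner_stdGaussian (EuclideanSpace.single (0 : Fin 1) (1 : ℝ))
    simp only [EuclideanSpace.inner_single_right, PiLp.norm_single, norm_one, one_mul,
      Measure.map_id', conj_trivial] at h
    rw [← h, Measure.map_apply (by fun_prop) measurableSet_Icc]
    rfl
  have h2 : ∀ i, P (g i ⁻¹' {x | x 0 ∈ Set.Icc a b}) = gaussianReal 0 1 (Set.Icc a b) := by
    intro i
    rw [← h1, ← (hlaw i).map_eq, Measure.map_apply_of_aemeasurable (hlaw i).aemeasurable hm]
  have h3 : {ω | ∀ i, g i ω 0 ∈ Set.Icc a b} =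
      ⋂ i ∈ Finset.univ, g i ⁻¹' {x | x 0 ∈ Set.Icc a b} := by
    ext ω; simp
  rw [measureReal_def, h3, hind.measure_inter_preimage_eq_mul Finset.univ fun _ _ => hm,
    Finset.prod_congr rfl fun i _ => h2 i]
  simp [measureReal_def]

lemma gaussianReal_real_Icc_pos {a b : ℝ} (hab : a < b) :
    0 < (gaussianReal 0 1).real (Set.Icc a b) := by
  rw [measureReal_def, ENNReal.toReal_pos_iff]
  refine ⟨pos_iff_ne_zero.2 fun h => ?_, measure_lt_top _ _⟩
  have := gaussianReal_absolutelyContinuous' 0 one_ne_zero h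
  rw [Real.volume_Icc, ENNReal.ofReal_eq_zero] at this
  linarith

lemma one_sub_le_measureReal {Ω : Type*} [MeasurableSpace Ω] (P : Measure Ω)
    [IsProbabilityMeasure P] {p : Ω → Prop} {δ : ℝ} (h : P.real {ω | ¬ p ω} ≤ δ) :
    1 - δ ≤ P.real {ω | p ω} := by
  have h1 := measureReal_union_le (μ := P) {ω | p ω} {ω | ¬ p ω}
  have h2 : {ω | p ω} ∪ {ω | ¬ p ω} = Set.univ := Set.union_compl_self _
  rw [h2, probReal_univ] at h1
  linarith

/-- Uniform relative concentration for standard Gaussian frequencies. -/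
lemma exists_one_sub_le_measureReal_uniform : ∃ C : ℝ, 0 < C ∧
    ∀ {Ω : Type*} [MeasurableSpace Ω] (P : Measure Ω) [IsProbabilityMeasure P] (d t : ℕ)
      (ε δ M : ℝ) (g : Fin t → Ω → EuclideanSpace ℝ (Fin d)),
      1 ≤ d → 0 < ε → ε < 1 → 0 < δ → δ < 1 → 1 ≤ M →
      C * (d / ε ^ 2) * Real.log (d / ε * (M / δ)) ≤ t → iIndepFun g P →
      (∀ i, HasLaw (g i) (stdGaussian _) P) →
      1 - δ ≤ P.real {ω | ∀ u, ‖u‖ ≤ M →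
        |cosDefect (fun i => g i ω) u - gaussianDefect ‖u‖| ≤ ε * gaussianDefect ‖u‖} := by
  obtain ⟨C, hC, H⟩ := exists_measureReal_uniform_le
  set p := (gaussianReal 0 1).real (Set.Icc (1 / 2 : ℝ) (9 / 10)) with hp
  have hp0 : 0 < p := gaussianReal_real_Icc_pos (by norm_num)
  have hp1 : p ≤ 1 := measureReal_le_one
  set T := ⌈C * 2 * (1 + Real.log 4)⌉₊
  -- Threshold for `log Q`: the first term forces all parameters near `1`, the second makes the
  -- explicit event likely enough when `t < T`.
  set η := min (Real.log (11 / 10)) (p ^ T)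
  have hη : 0 < η := lt_min (Real.log_pos (by norm_num)) (by positivity)
  refine ⟨C * (1 + 1 / η), by positivity, ?_⟩
  intro Ω _ P _ d t ε δ M g hd hε hε1 hδ hδ1 hM ht hind hlaw
  have hd' : (1 : ℝ) ≤ d := by exact_mod_cast hd
  have hinvε : 1 < 1 / ε := by rw [lt_div_iff₀ hε]; linarith
  have hinvδ : 1 < 1 / δ := by rw [lt_div_iff₀ hδ]; linarith
  set Q := d / ε * (M / δ) with hQ
  have hQe : Q = d * M * (1 / ε) * (1 / δ) := by rw [hQ]; field_simp
  have hdM : 1 ≤ d * M := one_le_mul_of_one_le_of_one_le hd' hM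
  have hdMε : 1 ≤ d * M * (1 / ε) := one_le_mul_of_one_le_of_one_le hdM hinvε.le
  have hQδ : 1 / δ ≤ Q := by rw [hQe]; exact le_mul_of_one_le_left (by positivity) hdMε
  have hQ1 : 1 < Q := hinvδ.trans_le hQδ
  have hlog : 0 < Real.log Q := Real.log_pos hQ1
  have ht0 : 0 < t := by
    have : (0 : ℝ) < t := lt_of_lt_of_le (by positivity) ht
    exact_mod_cast this
  rcases le_or_gt η (Real.log Q) with h | h
  · apply one_sub_le_measureReal
    refine H P d t ε δ M g hd hε hε1 hδ hδ1 hM ht0 (le_trans ?_ ht) hind hlaw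
    have h1 : 1 + Real.log Q ≤ (1 + 1 / η) * Real.log Q := by
      have : 1 ≤ 1 / η * Real.log Q := by
        rw [one_div_mul_eq_div, le_div_iff₀ hη]; linarith
      linarith
    calc _ ≤ C * (d / ε ^ 2) * ((1 + 1 / η) * Real.log Q) := by gcongr
      _ = _ := by ring
  -- `Q` is the product of `d`, `M`, `1 / ε` and `1 / δ`, all at least `1`, so each is below `11 /
  -- 10`.
  have hQlt : Q < 11 / 10 :=
    (Real.log_lt_log_iff (by linarith) (by norm_num)).1 (h.trans_le (min_le_left _ _))
  have hdMεlt : d * M * (1 / ε) < 11 / 10 := by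
    refine lt_of_le_of_lt ?_ hQlt
    rw [hQe]; exact le_mul_of_one_le_right (by positivity) hinvδ.le
  have hdMlt : d * M < 11 / 10 :=
    lt_of_le_of_lt (le_mul_of_one_le_right (by positivity) hinvε.le) hdMεlt
  have hεlt : 1 / ε < 11 / 10 :=
    lt_of_le_of_lt (le_mul_of_one_le_left (by positivity) hdM) hdMεlt
  have hε9 : 9 / 10 ≤ ε := by
    rw [div_lt_iff₀ hε] at hεlt; linarith
  have hδ9 : 1 / 2 ≤ δ := by
    have := hQδ.trans_lt hQlt
    rw [div_lt_iff₀ hδ] at this; linarith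
  have hMlt : M < 11 / 10 := lt_of_le_of_lt (le_mul_of_one_le_left (by positivity) hd') hdMlt
  obtain rfl : d = 1 := by
    have h1 : (d : ℝ) < 2 := by
      have : (d : ℝ) ≤ d * M := le_mul_of_one_le_right (by positivity) hM
      linarith
    have : d < 2 := by exact_mod_cast h1
    omega
  rcases le_or_gt T t with hT | hT
  -- Failure probability `1 / 2 ≤ δ` is enough; `T` is sized for `d / ε ^ 2 ≤ 2` and a logarithm of
  -- at most `log 4`.
  · apply one_sub_le_measureReal
    refine (H P 1 t ε (1 / 2) M g le_rfl hε hε1 (by norm_num) (by norm_num) hM ht0 ?_ hind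
      hlaw).trans hδ9
    have h1 : C * 2 * (1 + Real.log 4) ≤ t := (Nat.le_ceil _).trans (by exact_mod_cast hT)
    refine le_trans ?_ h1
    have h2 : ((1 : ℕ) : ℝ) / ε ^ 2 ≤ 2 := by
      rw [div_le_iff₀ (by positivity)]; push_cast; nlinarith
    have h3 : ((1 : ℕ) : ℝ) / ε * (M / (1 / 2)) ≤ 4 := by
      have : ((1 : ℕ) : ℝ) / ε * (M / (1 / 2)) = 2 * (((1 : ℕ) : ℝ) * M * (1 / ε)) := by
        push_cast; ring
      linarith
    have h5 : 1 ≤ ((1 : ℕ) : ℝ) / ε * (M / (1 / 2)) := by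
      have : ((1 : ℕ) : ℝ) / ε * (M / (1 / 2)) = 2 * (((1 : ℕ) : ℝ) * M * (1 / ε)) := by
        push_cast; ring
      linarith
    have h6 : 0 ≤ Real.log (((1 : ℕ) : ℝ) / ε * (M / (1 / 2))) := Real.log_nonneg h5
    gcongr
  -- Fewer than `T` samples: `1 - δ ≤ log (1 / δ) ≤ log Q < η ≤ p ^ T ≤ p ^ t`, the last being the
  -- probability that all frequencies lie in the interval.
  · have h1 : 1 - δ ≤ p ^ t := by
      have h2 : 1 - δ ≤ Real.log (1 / δ) := by
        have := Real.log_le_sub_one_of_pos hδ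
        rw [one_div, Real.log_inv]; linarith
      have h3 : Real.log (1 / δ) ≤ Real.log Q := Real.log_le_log (by positivity) hQδ
      have h4 : η ≤ p ^ t :=
        (min_le_right _ _).trans (pow_le_pow_of_le_one hp0.le hp1 hT.le)
      linarith
    refine h1.trans ?_
    rw [hp, ← measureReal_forall_mem_Icc_eq_pow hind hlaw]
    refine measureReal_mono fun ω hω u hu => ?_
    refine (abs_cosDefect_sub_gaussianDefect_le_of_mem_Icc ht0 _ hω u (by linarith)).trans ?_
    exact mul_le_mul_of_nonneg_right hε9 (gaussianDefect_nonneg _)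

theorem mainTheorem3 :
    ∃ C : ℝ, 0 < C ∧
      ∀ (d t : ℕ) (ε δ σ M : ℝ), 1 ≤ d → 0 < ε → ε < 1 → 0 < δ → δ < 1 → 0 < σ → 0 ≤ M →
        C * ((d : ℝ) / ε ^ 2) * Real.log ((d : ℝ) / ε * (max M 1 / δ)) ≤ (t : ℝ) →
        ∀ {Ω : Type*} [MeasurableSpace Ω] (P : Measure Ω) [IsProbabilityMeasure P]
          (w : Fin t → Ω → EuclideanSpace ℝ (Fin d)),
          iIndepFun w P →
          (∀ i, HasLaw (w i)
            (multivariateGaussian 0 ((σ ^ 2)⁻¹ • (1 : Matrix (Fin d) (Fin d) ℝ))) P) →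
          ENNReal.ofReal (1 - δ) ≤
            P {a | ∀ x y : EuclideanSpace ℝ (Fin d), x ≠ y → ‖x - y‖ / σ ≤ M →
              kernelDist (featureKernel fun i => w i a) x y ^ 2 /
                  kernelDist (gaussianKernel σ) x y ^ 2 ∈ Set.Icc (1 - ε) (1 + ε)} := by
  obtain ⟨C, hC, H⟩ := exists_one_sub_le_measureReal_uniform
  refine ⟨C, hC, ?_⟩
  intro d t ε δ σ M hd hε hε1 hδ hδ1 hσ _ ht Ω _ P _ w hind hlaw
  have hind' : iIndepFun (fun i ω => σ • w i ω) P :=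
    hind.comp (fun _ x => σ • x) fun _ => by fun_prop
  have hlaw' : ∀ i, HasLaw (fun ω => σ • w i ω) (stdGaussian (EuclideanSpace ℝ (Fin d))) P := by
    intro i
    have h : HasLaw (fun x : EuclideanSpace ℝ (Fin d) => σ • x) (stdGaussian _)
        (multivariateGaussian 0 ((σ ^ 2)⁻¹ • (1 : Matrix (Fin d) (Fin d) ℝ))) :=
      ⟨by fun_prop, map_smul_multivariateGaussian hσ⟩
    exact h.comp (hlaw i)
  have h := H P d t ε δ (max M 1) _ hd hε hε1 hδ hδ1 (le_max_right _ _) ht hind' hlaw'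
  refine ENNReal.ofReal_le_of_le_toReal (h.trans (measureReal_mono fun ω hω x y hxy hM => ?_))
  have hn : ‖σ⁻¹ • (x - y)‖ = ‖x - y‖ / σ := by
    rw [norm_smul, norm_inv, Real.norm_of_nonneg hσ.le, inv_mul_eq_div]
  have h1 := abs_le.1 (hω (σ⁻¹ • (x - y)) (by rw [hn]; exact hM.trans (le_max_left _ _)))
  have hk : 0 < gaussianDefect ‖σ⁻¹ • (x - y)‖ := by
    apply gaussianDefect_pos
    rw [hn]
    have := norm_pos_iff.2 (sub_ne_zero.2 hxy)
    positivity
  rw [kernelDist_gaussianKernel_sq hσ, kernelDist_featureKernel_sq hσ,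
    mul_div_mul_left _ _ two_ne_zero, Set.mem_Icc, le_div_iff₀ hk, div_le_iff₀ hk]
  constructor <;> linarith
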